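/- All digraphs are finite, non-empty oriented graphs: no loops and at most one arc between any two vertices. For a vertex $v$ of $D$, $N^+(v)$ is the set of out-neighbors of $v$, and $N^{++}(v)$ is the set of vertices $w\notin N^+(v)\cup\{v\}$ such that $v\to u\to w$ for some $u$. The vertex $v$ has the second neighborhood property (SNP) if $|N^+(v)|\le |N^{++}(v)|$. A missing edge of $D$ is an unordered pair $ab$ of distinct vertices with no arc between $a$ and $b$ in either direction. The dependency digraph $\Delta$ of $D$ has the missing edges of $D$ as its vertices, with an arc from $xy$ to $ab$ if, for a suitable naming of the ends of the two missing edges, $x\to a$, $b\notin N^+(x)\cup N^{++}(x)$, $y\to b$ and $a\notin N^+(y)\cup N^{++}(y)$. We say that $D$ is a tournament missing disjoint paths of length $2$ if the graph formed by the missing edges of $D$ is a vertex-disjoint union of paths with exactly two edges (three vertices) each. **Theorem.** Let $D$ be a tournament missing disjoint paths of length $2$, and let $\Delta$ be its dependency digraph. If $d^+_\Delta(ab)=d^-_\Delta(ab)=2$ for every $ab\in V(\Delta)$, then $D$ has a vertex with the SNP. -/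

import Mathlib

namespace Digraph

variable {V : Type*}

/-- An oriented graph: no loops, and at most one arc between any two vertices. -/
structure IsOrientedGraph (D : Digraph V) : Prop where
  loopless : ∀ v, ¬ D.Adj v v
  asymm : ∀ u v, D.Adj u v → ¬ D.Adj v u

/-- The out-neighborhood of `v`. -/
def outNbhd (D : Digraph V) (v : V) : Set V := {w | D.Adj v w}

/-- The second out-neighborhood of `v`: the vertices at distance exactly two from `v`. -/
def secondOutNbhd (D : Digraph V) (v : V) : Set V :=
  {w | w ≠ v ∧ w ∉ D.outNbhd v ∧ ∃ u ∈ D.outNbhd v, w ∈ D.outNbhd u}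

/-- The second neighborhood property of a vertex. -/
def HasSNP (D : Digraph V) (v : V) : Prop :=
  (D.outNbhd v).ncard ≤ (D.secondOutNbhd v).ncard

/-- The graph of the missing edges of `D`. It is kept on all of `V`, so that the whole vertices
of `D` are exactly its isolated vertices. -/
def missingGraph (D : Digraph V) : SimpleGraph V where
  Adj u v := u ≠ v ∧ ¬ D.Adj u v ∧ ¬ D.Adj v u
  symm := ⟨fun _ _ h => ⟨h.1.symm, h.2.2, h.2.1⟩⟩
  loopless := ⟨fun _ h => h.1 rfl⟩

/-- The missing graph of `D` is a disjoint union of paths of length 2 (that is, with two edges and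
three vertices): apart from the isolated vertices, which are the whole vertices of `D`, every
connected component is such a path. -/
def MissesDisjointPathsOfLengthTwo (D : Digraph V) : Prop :=
  ∀ c : D.missingGraph.ConnectedComponent,
    c.supp.Subsingleton ∨ Nonempty (c.toSimpleGraph ≃g SimpleGraph.pathGraph 3)

/-- The losing relation between unordered pairs of vertices: the ends can be named so that
`x → a`, `y → b`, while `b` is not in `N⁺(x) ∪ N⁺⁺(x)` and `a` is not in `N⁺(y) ∪ N⁺⁺(y)`. -/
def Loses (D : Digraph V) (e f : Sym2 V) : Prop :=
  ∃ x y a b : V, e = s(x, y) ∧ f = s(a, b) ∧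
    D.Adj x a ∧ b ∉ D.outNbhd x ∪ D.secondOutNbhd x ∧
    D.Adj y b ∧ a ∉ D.outNbhd y ∪ D.secondOutNbhd y

/-- The dependency digraph: its vertices are the missing edges, its arcs the losing relations. -/
def dependencyDigraph (D : Digraph V) : Digraph D.missingGraph.edgeSet where
  Adj e f := D.Loses e f

/-- The out-degree of a vertex (meaningful for finite digraphs). -/
noncomputable def outDeg (D : Digraph V) (v : V) : ℕ := {w | D.Adj v w}.ncard

/-- The in-degree of a vertex (meaningful for finite digraphs). -/
noncomputable def inDeg (D : Digraph V) (v : V) : ℕ := {w | D.Adj w v}.ncard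

end Digraph

/-! When all degrees in the dependency digraph are 2, losing respects whole missing paths: an edge
loses to both edges of one path, and both edges of one path lose to it (`LosingRegular`). So losing
is injective on paths, and following it returns to the start.

If `Step a b`, no out-neighbour of `a` dominates `b`, so each one outside the component of `b` is an
out-neighbour of `b`. Closing up under steps gives classes that are modules. The first return to the
component of `a` lands on the other side of the path (midpoint versus ends), so a class contains
both ends of its missing edges. Contracting the classes therefore leaves a tournament, weighted by
class sizes.

The last vertex of a median order of this tournament is a class satisfying the weighted inequality.
Inside each class some vertex satisfies the inequality relative to the class, by an extremal choice
of in-neighbourhood (`exists_ncard_le_in_class`). Since classes are modules, the two inequalities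
add up. -/

/-! ### Median orders of weighted tournaments -/

/-- The total weight of the vertices of a list which satisfy a predicate. -/
noncomputable def List.weight {Q : Type*} (w : Q → ℕ) (l : List Q) (p : Q → Prop) : ℕ :=
  open Classical in (l.map fun b => if p b then w b else 0).sum

namespace List

variable {Q : Type*} {w : Q → ℕ}

@[simp] theorem weight_nil (p : Q → Prop) : ([] : List Q).weight w p = 0 := rfl

theorem weight_cons (a : Q) (l : List Q) (p : Q → Prop) [Decidable (p a)] :
    (a :: l).weight w p = (if p a then w a else 0) + l.weight w p := by
  simp only [weight, map_cons, sum_cons]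
  congr

theorem weight_append (l m : List Q) (p : Q → Prop) :
    (l ++ m).weight w p = l.weight w p + m.weight w p := by
  simp [weight]

theorem weight_mono {l : List Q} {p q : Q → Prop} (h : ∀ b ∈ l, p b → q b) :
    l.weight w p ≤ l.weight w q := by
  classical
  induction l with
  | nil => simp
  | cons a l ih =>
    rw [weight_cons, weight_cons]
    have := ih fun b hb => h b (mem_cons_of_mem _ hb)
    have h1 := h a mem_cons_self
    split_ifs <;> grind

/-- The total weight of the forward arcs of a list. -/
noncomputable def forward (R : Q → Q → Prop) (w : Q → ℕ) : List Q → ℕ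
  | [] => 0
  | a :: l => w a * l.weight w (R a) + forward R w l

/-- The total weight of the arcs from one list to another. -/
noncomputable def crossing (R : Q → Q → Prop) (w : Q → ℕ) (l m : List Q) : ℕ :=
  (l.map fun a => w a * m.weight w (R a)).sum

theorem forward_append (R : Q → Q → Prop) (l m : List Q) :
    forward R w (l ++ m) = forward R w l + forward R w m + crossing R w l m := by
  induction l with
  | nil => simp [forward, crossing]
  | cons a l ih =>
    simp only [cons_append, forward, ih, weight_append, crossing, map_cons, sum_cons]
    ring

theorem crossing_append_left (R : Q → Q → Prop) (l l' m : List Q) :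
    crossing R w (l ++ l') m = crossing R w l m + crossing R w l' m := by
  simp [crossing]

theorem crossing_append_right (R : Q → Q → Prop) (l m m' : List Q) :
    crossing R w l (m ++ m') = crossing R w l m + crossing R w l m' := by
  simp [crossing, weight_append, mul_add, sum_map_add]

theorem crossing_singleton_left (R : Q → Q → Prop) (x : Q) (m : List Q) :
    crossing R w [x] m = w x * m.weight w (R x) := by
  simp [crossing]

theorem crossing_singleton_right (R : Q → Q → Prop) (x : Q) (l : List Q) :
    crossing R w l [x] = w x * l.weight w (fun b => R b x) := by
  classical
  induction l with
  | nil => simp [crossing]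
  | cons a l ih =>
    rw [← singleton_append, crossing_append_left, ih, crossing_singleton_left, weight_append,
      weight_cons, weight_cons]
    by_cases h : R a x <;> simp [h, mul_add, mul_comm]

/-- A median order: no vertex gains forward arcs by moving it in front of vertices which
immediately precede it. -/
def IsMedian (R : Q → Q → Prop) (w : Q → ℕ) (l : List Q) : Prop :=
  ∀ A B C x, l = A ++ (B ++ ([x] ++ C)) →
    w x * B.weight w (R x) ≤ w x * B.weight w (fun b => R b x)

/-- Maximise the forward weight: moving `x` in front of `B` changes only the arcs between `x` and
`B`. -/
theorem exists_perm_isMedian (R : Q → Q → Prop) (w : Q → ℕ) (l : List Q) :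
    ∃ m, m ~ l ∧ IsMedian R w m := by
  classical
  obtain ⟨m, hm, hmax⟩ := Finset.exists_max_image l.permutations.toFinset (forward R w)
    ⟨l, by simp⟩
  simp only [mem_toFinset, mem_permutations] at hm hmax
  refine ⟨m, hm, ?_⟩
  rintro A B C x rfl
  have hp : A ++ ([x] ++ (B ++ C)) ~ A ++ (B ++ ([x] ++ C)) := by
    refine Perm.append_left _ ?_
    simp only [singleton_append]
    exact perm_middle.symm
  have := hmax _ (hp.trans hm)
  simp only [forward_append, crossing_append_right,
    crossing_singleton_left, crossing_singleton_right] at this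
  linarith

/-- In a median order of a tournament, the last vertex has at most as much weight in its
out-neighbourhood as in its second out-neighbourhood. -/
theorem weight_out_le_weight_second {R : Q → Q → Prop}
    (htotal : ∀ a b, a ≠ b → R a b ∨ R b a) (hasymm : ∀ a b, R a b → ¬ R b a)
    (hw : ∀ a, 0 < w a) (x : Q) (n : ℕ) :
    ∀ l : List Q, l.length = n → x ∉ l → IsMedian R w (l ++ [x]) →
      l.weight w (R x) ≤ l.weight w (fun b => R b x ∧ ∃ u, R x u ∧ R u b) := by
  induction n using Nat.strong_induction_on with
  | _ n ih =>
  intro l hl hx hmed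
  classical
  -- A bad vertex is an in-neighbour of `x` that is not a second out-neighbour. Split at the first
  -- bad `y`; the suffix after it stays median, for induction. Before it, `x`'s out-neighbours are
  -- `y`'s, and `y`'s in-neighbours are second out-neighbours of `x`.
  by_cases hbad : ∃ y ∈ l, R y x ∧ ∀ u, R x u → ¬ R u y
  · obtain ⟨y', hmem, hyp⟩ := hbad
    obtain ⟨y, B, C, hB, hy, rfl, -⟩ := exists_of_eraseP
      (p := fun y => decide (R y x ∧ ∀ u, R x u → ¬ R u y)) hmem (by simpa using hyp)
    simp only [decide_eq_true_eq] at hB hy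
    have hC := ih C.length (by simp [← hl]; omega) C rfl (by simp_all)
      (fun A B' C' z h => hmed (B ++ y :: A) B' C' z (by simp [h]))
    have h0 := Nat.le_of_mul_le_mul_left (hmed [] B (C ++ [x]) y (by simp)) (hw y)
    have h1 : B.weight w (R x) ≤ B.weight w (R y) := weight_mono fun b _ hb =>
      (htotal b y (by rintro rfl; exact hasymm _ _ hb hy.1)).resolve_left (hy.2 b hb)
    have h2 : B.weight w (fun b => R b y) ≤
        B.weight w (fun b => R b x ∧ ∃ u, R x u ∧ R u b) := by
      refine weight_mono fun b hb hby => ?_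
      have hbx : R b x := (htotal b x (by rintro rfl; simp_all)).resolve_right
        fun h => hy.2 b h hby
      refine ⟨hbx, ?_⟩
      by_contra hno
      exact hB b hb ⟨hbx, fun u hu hub => hno ⟨u, hu, hub⟩⟩
    rw [weight_append, weight_append, weight_cons, weight_cons, if_neg (hasymm _ _ hy.1)]
    omega
  · push Not at hbad
    have := hmed [] l [] x (by simp)
    have := Nat.le_of_mul_le_mul_left this (hw x)
    exact this.trans (weight_mono fun b hb hbx => ⟨hbx, hbad b hb hbx⟩)

end List

/-- In a weighted tournament some vertex has at most as much weight in its out-neighbourhood as in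
its second out-neighbourhood. -/
theorem exists_weight_out_le_weight_second {Q : Type*} [Fintype Q] [Nonempty Q]
    {R : Q → Q → Prop} {w : Q → ℕ} (htotal : ∀ a b, a ≠ b → R a b ∨ R b a)
    (hasymm : ∀ a b, R a b → ¬ R b a) (hw : ∀ a, 0 < w a) :
    ∃ x, open Classical in (∑ b with R x b, w b) ≤ ∑ b with R b x ∧ ∃ u, R x u ∧ R u b, w b := by
  classical
  obtain ⟨m, hm, hmed⟩ := List.exists_perm_isMedian R w (Finset.univ : Finset Q).toList
  have hne : m ≠ [] := by
    rintro rfl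
    exact Finset.univ_nonempty.ne_empty (by simpa using hm)
  obtain ⟨l, x, rfl⟩ := (List.eq_nil_or_concat' m).resolve_left hne
  have hnd : (l ++ [x]).Nodup := hm.nodup_iff.2 (Finset.nodup_toList _)
  have hx : x ∉ l := by
    rw [List.nodup_append] at hnd
    exact fun h => hnd.2.2 x h x (by simp) rfl
  have key := List.weight_out_le_weight_second htotal hasymm hw x _ l rfl hx hmed
  -- Neither predicate holds at `x`, so the sum over `l` is the sum over all vertices.
  have hsum : ∀ p : Q → Prop, ¬ p x → l.weight w p = ∑ b with p b, w b := by
    intro p hp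
    have h1 : l.weight w p = (l ++ [x]).weight w p := by
      rw [List.weight_append, List.weight_cons, if_neg hp, List.weight_nil,
        add_zero, add_zero]
    rw [h1, List.weight, (hm.map _).sum_eq, Finset.sum_map_toList, Finset.sum_filter]
  have hxx : ¬ R x x := fun h => hasymm x x h h
  refine ⟨x, ?_⟩
  rw [hsum _ hxx, hsum _ (fun h => hxx h.1)] at key
  convert key
-- The losing relation and missing paths
namespace Digraph

variable {V : Type*} {D : Digraph V}

/-- The missing edge `xy` loses to the missing edge `ab`, with `x → a` and `y → b`. -/
structure Los (D : Digraph V) (x y a b : V) : Prop where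
  left : D.missingGraph.Adj x y
  right : D.missingGraph.Adj a b
  fst : D.Adj x a
  snd : D.Adj y b
  fst_not : ¬ D.Adj x b
  snd_not : ¬ D.Adj y a
  fst_two : ∀ u, D.Adj x u → ¬ D.Adj u b
  snd_two : ∀ u, D.Adj y u → ¬ D.Adj u a

theorem Los.symm {x y a b : V} (h : D.Los x y a b) : D.Los y x b a :=
  ⟨h.left.symm, h.right.symm, h.snd, h.fst, h.snd_not, h.fst_not, h.snd_two, h.fst_two⟩

theorem not_mem_union_iff {x b : V} (hne : b ≠ x) :
    b ∉ D.outNbhd x ∪ D.secondOutNbhd x ↔ ¬ D.Adj x b ∧ ∀ u, D.Adj x u → ¬ D.Adj u b := by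
  simp only [outNbhd, secondOutNbhd, Set.mem_union, Set.mem_ofPred_eq]
  grind

theorem loses_iff {x y : V} (hxy : D.missingGraph.Adj x y) {f : Sym2 V}
    (hf : f ∈ D.missingGraph.edgeSet) :
    D.Loses s(x, y) f ↔ ∃ a b, f = s(a, b) ∧ D.Los x y a b := by
  have key : ∀ x y a b : V, D.missingGraph.Adj x y → D.missingGraph.Adj a b →
      (D.Adj x a ∧ b ∉ D.outNbhd x ∪ D.secondOutNbhd x ∧
        D.Adj y b ∧ a ∉ D.outNbhd y ∪ D.secondOutNbhd y → D.Los x y a b) ∧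
      (D.Los x y a b → D.Adj x a ∧ b ∉ D.outNbhd x ∪ D.secondOutNbhd x ∧
        D.Adj y b ∧ a ∉ D.outNbhd y ∪ D.secondOutNbhd y) := by
    intro x y a b hxy hab
    refine ⟨fun ⟨h1, h2, h3, h4⟩ => ?_, fun h => ?_⟩
    · have hb : b ≠ x := by rintro rfl; exact hab.2.2 h1
      have ha : a ≠ y := by rintro rfl; exact hab.2.1 h3
      rw [not_mem_union_iff hb] at h2
      rw [not_mem_union_iff ha] at h4
      exact ⟨hxy, hab, h1, h3, h2.1, h4.1, h2.2, h4.2⟩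
    · have hb : b ≠ x := by rintro rfl; exact hab.2.2 h.fst
      have ha : a ≠ y := by rintro rfl; exact hab.2.1 h.snd
      rw [not_mem_union_iff hb, not_mem_union_iff ha]
      exact ⟨h.fst, ⟨h.fst_not, h.fst_two⟩, h.snd, h.snd_not, h.snd_two⟩
  constructor
  · rintro ⟨x', y', a, b, he, rfl, h⟩
    rw [SimpleGraph.mem_edgeSet] at hf
    rw [Sym2.eq_iff] at he
    rcases he with ⟨rfl, rfl⟩ | ⟨rfl, rfl⟩
    · exact ⟨a, b, rfl, (key _ _ _ _ hxy hf).1 h⟩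
    · exact ⟨b, a, Sym2.eq_swap, ((key _ _ _ _ hxy.symm hf).1 h).symm⟩
  · rintro ⟨a, b, rfl, h⟩
    exact ⟨x, y, a, b, rfl, rfl, (key _ _ _ _ hxy h.right).2 h⟩

/-- Two missing edges to which `xy` loses are linked in the missing graph. -/
theorem Los.link_right {x y a b c d : V} (h : D.Los x y a b) (h' : D.Los x y c d) :
    D.missingGraph.Adj b c := by
  refine ⟨?_, h'.snd_two b h.snd, h.fst_two c h'.fst⟩
  rintro rfl
  exact h.fst_not h'.fst

/-- Two missing edges which lose to `xy` are linked in the missing graph. -/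
theorem Los.link_left {x y a b c d : V} (h : D.Los a b x y) (h' : D.Los c d x y) :
    D.missingGraph.Adj a d := by
  refine ⟨?_, fun had => h.fst_two d had h'.snd, fun hda => h'.snd_two a hda h.fst⟩
  rintro rfl
  exact h.fst_not h'.snd

/-- In a disjoint union of paths of length two, there is no walk of length three without
backtracking, and vertices have at most two neighbours. -/
theorem MissesDisjointPathsOfLengthTwo.local (h : D.MissesDisjointPathsOfLengthTwo) :
    (∀ a b c d, D.missingGraph.Adj a b → D.missingGraph.Adj b c → D.missingGraph.Adj c d →
      a = c ∨ b = d) ∧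
    (∀ b a c d, D.missingGraph.Adj b a → D.missingGraph.Adj b c → D.missingGraph.Adj b d →
      a = c ∨ a = d ∨ c = d) := by
  -- Coordinates 0, 1, 2 along the path turn both claims into arithmetic; the value 0 off the
  -- component is never used.
  have key : ∀ b a, D.missingGraph.Adj b a →
      ∃ f : V → ℕ, (∀ u v, D.missingGraph.Reachable u b → D.missingGraph.Reachable v b →
        (f u = f v → u = v) ∧
        (D.missingGraph.Adj u v → f u + 1 = f v ∨ f v + 1 = f u) ∧ f u < 3) := by
    intro b a hba
    classical
    rcases h (D.missingGraph.connectedComponentMk b) with hs | he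
    · exact absurd (hs (SimpleGraph.ConnectedComponent.mem_supp_iff _ _ |>.2 rfl)
        ((SimpleGraph.ConnectedComponent.mem_supp_iff _ _).2
          (SimpleGraph.ConnectedComponent.sound hba.symm.reachable))) hba.1
    · obtain ⟨e⟩ := he
      have hm : ∀ u, D.missingGraph.Reachable u b →
          u ∈ (D.missingGraph.connectedComponentMk b).supp := fun u hu =>
        (SimpleGraph.ConnectedComponent.mem_supp_iff _ _).2
          (SimpleGraph.ConnectedComponent.sound hu)
      refine ⟨fun u => if hu : u ∈ (D.missingGraph.connectedComponentMk b).supp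
        then (e ⟨u, hu⟩ : Fin 3).1 else 0, fun u v hu hv => ?_⟩
      simp only [hm u hu, hm v hv, dif_pos]
      refine ⟨fun huv => ?_, fun huv => ?_, (e ⟨u, hm u hu⟩).2⟩
      · have := e.injective (Fin.ext huv)
        exact congrArg Subtype.val this
      · have : (SimpleGraph.pathGraph 3).Adj (e ⟨u, hm u hu⟩) (e ⟨v, hm v hv⟩) :=
          e.map_adj_iff.2 huv
        rwa [SimpleGraph.pathGraph_adj] at this
  refine ⟨fun a b c d hab hbc hcd => ?_, fun b a c d hba hbc hbd => ?_⟩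
  · obtain ⟨f, hf⟩ := key b c hbc
    have ra := hab.reachable
    have rb := SimpleGraph.Reachable.refl (G := D.missingGraph) b
    have rc := hbc.symm.reachable
    have rd := hcd.symm.reachable.trans rc
    have h1 := hf a b ra rb
    have h2 := hf b c rb rc
    have h3 := hf c d rc rd
    have h4 := hf a c ra rc
    have h5 := hf b d rb rd
    have h6 := hf d d rd rd
    have := h1.2.1 hab
    have := h2.2.1 hbc
    have := h3.2.1 hcd
    have : f a = f c ∨ f b = f d := by omega
    exact this.imp h4.1 h5.1
  · obtain ⟨f, hf⟩ := key b c hbc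
    have ra := hba.symm.reachable
    have rb := SimpleGraph.Reachable.refl (G := D.missingGraph) b
    have rc := hbc.symm.reachable
    have rd := hbd.symm.reachable
    have h1 := hf a c ra rc
    have h2 := hf a d ra rd
    have h3 := hf c d rc rd
    have h6 := hf d d rd rd
    have := (hf b a rb ra).2.1 hba
    have := (hf b c rb rc).2.1 hbc
    have := (hf b d rb rd).2.1 hbd
    have : f a = f c ∨ f a = f d ∨ f c = f d := by omega
    exact this.imp h1.1 (Or.imp h2.1 h3.1)

/-- The local structure of a digraph all of whose missing edges lose to, and are lost to by,
precisely the missing edges of one component of the missing graph. -/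
structure LosingRegular (D : Digraph V) : Prop where
  oriented : D.IsOrientedGraph
  no_long_walk : ∀ {a b c d}, D.missingGraph.Adj a b → D.missingGraph.Adj b c →
    D.missingGraph.Adj c d → a = c ∨ b = d
  degree_le_two : ∀ {b a c d}, D.missingGraph.Adj b a → D.missingGraph.Adj b c →
    D.missingGraph.Adj b d → a = c ∨ a = d ∨ c = d
  extend_right : ∀ {x y a b c}, D.Los x y a b → D.missingGraph.Adj b c → D.Los x y c b
  extend_left : ∀ {x y z a b}, D.Los x y a b → D.missingGraph.Adj y z → D.Los z y a b
  exists_right : ∀ {x y}, D.missingGraph.Adj x y → ∃ a b, D.Los x y a b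
  exists_left : ∀ {a b}, D.missingGraph.Adj a b → ∃ x y, D.Los x y a b

/-- Two edges with a common loser or a common winner are linked crosswise in the missing graph. As
it has no long walk, they lie on one path; degree 2 then supplies the other edge of that path. -/
theorem losingRegular_of_degree_two (hD : D.IsOrientedGraph)
    (hmiss : D.MissesDisjointPathsOfLengthTwo)
    (hreg : ∀ e : D.missingGraph.edgeSet,
      D.dependencyDigraph.outDeg e = 2 ∧ D.dependencyDigraph.inDeg e = 2) :
    D.LosingRegular := by
  obtain ⟨hw, hdeg⟩ := hmiss.local
  have out : ∀ {x y}, D.missingGraph.Adj x y → ∀ f : Sym2 V,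
      ∃ a b, s(a, b) ≠ f ∧ D.Los x y a b := by
    intro x y hxy f
    obtain ⟨f₁, f₂, hne, hs⟩ := Set.ncard_eq_two.1 (hreg ⟨s(x, y), hxy⟩).1
    have h1 : f₁ ∈ {w | D.dependencyDigraph.Adj ⟨s(x, y), hxy⟩ w} := by rw [hs]; simp
    have h2 : f₂ ∈ {w | D.dependencyDigraph.Adj ⟨s(x, y), hxy⟩ w} := by rw [hs]; simp
    obtain ⟨a, b, e1, l1⟩ := (loses_iff hxy f₁.2).1 h1
    obtain ⟨c, d, e2, l2⟩ := (loses_iff hxy f₂.2).1 h2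
    by_cases hf : s(a, b) = f
    · refine ⟨c, d, fun h => hne (Subtype.ext ?_), l2⟩
      rw [e1, e2, hf, h]
    · exact ⟨a, b, hf, l1⟩
  have inn : ∀ {a b}, D.missingGraph.Adj a b → ∀ f : Sym2 V,
      ∃ x y, s(x, y) ≠ f ∧ D.Los x y a b := by
    intro a b hab f
    have aux : ∀ e : D.missingGraph.edgeSet, D.dependencyDigraph.Adj e ⟨s(a, b), hab⟩ →
        ∃ x y, e.1 = s(x, y) ∧ D.Los x y a b := by
      rintro ⟨e, he⟩ h
      induction e with | _ x y
      obtain ⟨c, d, e1, l1⟩ := (loses_iff he hab).1 h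
      rw [Sym2.eq_iff] at e1
      rcases e1 with ⟨rfl, rfl⟩ | ⟨rfl, rfl⟩
      · exact ⟨x, y, rfl, l1⟩
      · exact ⟨y, x, Sym2.eq_swap, l1.symm⟩
    obtain ⟨f₁, f₂, hne, hs⟩ := Set.ncard_eq_two.1 (hreg ⟨s(a, b), hab⟩).2
    have h1 : f₁ ∈ {w | D.dependencyDigraph.Adj w ⟨s(a, b), hab⟩} := by rw [hs]; simp
    have h2 : f₂ ∈ {w | D.dependencyDigraph.Adj w ⟨s(a, b), hab⟩} := by rw [hs]; simp
    obtain ⟨x, y, e1, l1⟩ := aux _ h1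
    obtain ⟨z, t, e2, l2⟩ := aux _ h2
    by_cases hf : s(x, y) = f
    · refine ⟨z, t, fun h => hne (Subtype.ext ?_), l2⟩
      rw [e1, e2, hf, h]
    · exact ⟨x, y, hf, l1⟩
  refine ⟨hD, fun {a b c d} => hw a b c d, fun {b a c d} => hdeg b a c d, ?_, ?_, ?_, ?_⟩
  · intro x y a b c h hbc
    by_cases hca : c = a
    · exact hca ▸ h
    obtain ⟨c', d', hne, h'⟩ := out h.left s(a, b)
    have h1 := h.link_right h'
    have h2 := h.symm.link_right h'.symm
    rcases hw _ _ _ _ h.right h1 h'.right with rfl | rfl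
    · rcases hw _ _ _ _ hbc.symm h.right.symm h2 with rfl | rfl
      · exact absurd rfl hca
      · exact absurd rfl hne
    · rcases hdeg _ _ _ _ h.right.symm hbc h1 with rfl | rfl | rfl
      · exact absurd rfl hca
      · exact absurd rfl hne
      · exact h'
  · intro x y z a b h hyz
    by_cases hzx : z = x
    · exact hzx ▸ h
    obtain ⟨x', y', hne, h'⟩ := inn h.right s(x, y)
    have h1 := h.link_left h'
    have h2 := h.symm.link_left h'.symm
    rcases hw _ _ _ _ h.left h2 h'.left with rfl | rfl
    · rcases hw _ _ _ _ hyz.symm h.left.symm h1 with rfl | rfl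
      · exact absurd rfl hzx
      · exact absurd rfl hne
    · rcases hdeg _ _ _ _ h.left.symm hyz h2 with rfl | rfl | rfl
      · exact absurd rfl hzx
      · exact absurd rfl hne
      · exact h'
  · intro x y h
    obtain ⟨a, b, -, h'⟩ := out h s(x, x)
    exact ⟨a, b, h'⟩
  · intro a b h
    obtain ⟨x, y, -, h'⟩ := inn h s(a, a)
    exact ⟨x, y, h'⟩

/-! ### Steps and twins -/

/-- Some missing edge at `a` loses to some missing edge at `b`, and `a` does not dominate `b`. -/
def Step (D : Digraph V) (a b : V) : Prop := ∃ y c, D.Los a y c b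

/-- Two vertices have a common neighbour in the missing graph. -/
def Twin (D : Digraph V) (a b : V) : Prop :=
  ∃ y, D.missingGraph.Adj a y ∧ D.missingGraph.Adj y b

theorem Twin.symm {a b : V} (h : D.Twin a b) : D.Twin b a :=
  h.imp fun _ h => ⟨h.2.symm, h.1.symm⟩

theorem Step.exists_adj {a b : V} (hs : D.Step a b) :
    ∃ o o', D.missingGraph.Adj a o ∧ D.missingGraph.Adj b o' := by
  obtain ⟨y, c, hl⟩ := hs
  exact ⟨y, c, hl.left, hl.right.symm⟩

theorem Twin.reachable {a b : V} (ht : D.Twin a b) : D.missingGraph.Reachable a b := by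
  obtain ⟨y, h1, h2⟩ := ht
  exact h1.reachable.trans h2.reachable

/-- Out-neighbours of `a` in other components are passed on along steps. -/
theorem Step.adj_of_adj {a b w : V} (hs : D.Step a b) (haw : D.Adj a w)
    (hw : ¬ D.missingGraph.Reachable b w) : D.Adj b w := by
  obtain ⟨y, c, hl⟩ := hs
  by_contra hbw
  refine hw (SimpleGraph.Adj.reachable ⟨?_, hbw, hl.fst_two w haw⟩)
  rintro rfl
  exact hw (SimpleGraph.Reachable.refl _)

theorem exists_adj_of_reflTransGen {a b o : V} (ho : D.missingGraph.Adj a o)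
    (hr : Relation.ReflTransGen D.Step a b) : ∃ o', D.missingGraph.Adj b o' := by
  rcases hr.cases_tail with rfl | ⟨c, -, hs⟩
  · exact ⟨o, ho⟩
  · obtain ⟨-, o', -, ho'⟩ := hs.exists_adj
    exact ⟨o', ho'⟩

namespace LosingRegular

variable (h : D.LosingRegular)
include h

theorem irrefl (a : V) : ¬ D.Adj a a := h.oriented.loopless a

theorem los_of_adj {x y a b x' : V} (hl : D.Los x y a b) (hx : D.missingGraph.Adj x x') :
    D.Los x x' a b :=
  (h.extend_left hl.symm hx).symm

theorem los_of_adj' {x y a b c : V} (hl : D.Los x y a b) (hx : D.missingGraph.Adj a c) :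
    D.Los x y a c :=
  (h.extend_right hl.symm hx).symm

theorem step_of_twin_left {a a' b : V} (hs : D.Step a b) (ht : D.Twin a a') : D.Step a' b := by
  obtain ⟨y, c, hl⟩ := hs
  obtain ⟨z, h1, h2⟩ := ht
  exact ⟨z, c, h.extend_left (h.los_of_adj hl h1) h2⟩

theorem step_of_twin_right {a b b' : V} (hs : D.Step a b) (ht : D.Twin b b') : D.Step a b' := by
  obtain ⟨y, c, hl⟩ := hs
  obtain ⟨z, h1, h2⟩ := ht
  exact ⟨y, z, h.los_of_adj' (h.extend_right hl h1) h2⟩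

theorem step_opposite {a b o o' : V} (hs : D.Step a b) (ho : D.missingGraph.Adj a o)
    (ho' : D.missingGraph.Adj b o') : D.Step o o' := by
  obtain ⟨y, c, hl⟩ := hs
  exact ⟨a, b, (h.extend_right (h.los_of_adj hl ho) ho').symm⟩

theorem eq_or_adj_or_twin {a b : V} (hr : D.missingGraph.Reachable a b) :
    a = b ∨ D.missingGraph.Adj a b ∨ D.Twin a b := by
  obtain ⟨p⟩ := hr
  induction p with
  | nil => exact Or.inl rfl
  | cons hab p ih =>
    rcases ih with rfl | ih | ⟨y, h1, h2⟩
    · exact Or.inr (Or.inl hab)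
    · exact Or.inr (Or.inr ⟨_, hab, ih⟩)
    · rcases h.no_long_walk hab h1 h2 with rfl | rfl
      · exact Or.inr (Or.inl h2)
      · exact Or.inr (Or.inl hab)

theorem twin_or_adj {a b o : V} (ho : D.missingGraph.Adj a o)
    (hr : D.missingGraph.Reachable a b) : D.missingGraph.Adj a b ∨ D.Twin a b := by
  rcases h.eq_or_adj_or_twin hr with rfl | h' | h'
  · exact Or.inr ⟨o, ho, ho.symm⟩
  · exact Or.inl h'
  · exact Or.inr h'

/-- `b` dominates `a` whenever `a` steps to `b`. -/
theorem adj_of_step {a b : V} (hs : D.Step a b) : D.Adj b a := by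
  obtain ⟨y, c, hl⟩ := hs
  by_contra hba
  have hne : a ≠ b := by
    rintro rfl
    exact hl.right.2.2 hl.fst
  have hab : D.missingGraph.Adj a b := ⟨hne, hl.fst_not, hba⟩
  -- If `ab` were missing, it could replace `ay` in the losing relation, forcing a loop at `b`.
  exact (h.los_of_adj hl hab).snd |> h.irrefl b

/-- Together with `reachable_source`: steps induce an injective partial map on components. -/
theorem reachable_target {a a' b b' : V} (hs : D.Step a b) (hs' : D.Step a' b')
    (hr : D.missingGraph.Reachable a a') : D.missingGraph.Reachable b b' := by
  have key : ∀ {a b b'}, D.Step a b → D.Step a b' → D.missingGraph.Reachable b b' := by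
    rintro a b b' ⟨y, c, hl⟩ ⟨y', c', hl'⟩
    exact (hl.link_right (h.los_of_adj hl' hl.left)).reachable.trans hl'.right.reachable
  obtain ⟨o, o', ho, ho'⟩ := hs.exists_adj
  rcases h.twin_or_adj ho hr with h1 | h1
  · exact ho'.reachable.trans (key (h.step_opposite hs h1 ho') hs')
  · exact key (h.step_of_twin_left hs h1) hs'

theorem reachable_source {a a' b b' : V} (hs : D.Step a b) (hs' : D.Step a' b')
    (hr : D.missingGraph.Reachable b b') : D.missingGraph.Reachable a a' := by
  have key : ∀ {a a' b}, D.Step a b → D.Step a' b → D.missingGraph.Reachable a a' := by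
    rintro a a' b ⟨y, c, hl⟩ ⟨y', c', hl'⟩
    exact (hl.link_left (h.extend_right hl' hl.right.symm)).reachable.trans
      hl'.left.symm.reachable
  obtain ⟨o, o', ho, ho'⟩ := hs.exists_adj
  rcases h.twin_or_adj ho' hr with h1 | h1
  · exact ho.reachable.trans (key (h.step_opposite hs ho h1) hs')
  · exact key (h.step_of_twin_right hs h1) hs'

theorem exists_step {a o : V} (ho : D.missingGraph.Adj a o) : ∃ b, D.Step a b := by
  obtain ⟨c, b, hl⟩ := h.exists_right ho
  exact ⟨b, o, c, hl⟩

theorem exists_step_to {b o : V} (ho : D.missingGraph.Adj b o) : ∃ a, D.Step a b := by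
  obtain ⟨a, y, hl⟩ := h.exists_left ho.symm
  exact ⟨a, y, o, hl⟩

/-! ### Classes of vertices joined by steps -/

/-- From every vertex which is not whole there is a sequence of steps returning to its component. -/
theorem exists_closed_sequence [Finite V] {a b : V} (hs : D.Step a b) :
    ∃ (u : ℕ → V) (n : ℕ), u 0 = b ∧ (∀ i, D.Step (u i) (u (i + 1))) ∧
      D.missingGraph.Reachable (u n) a := by
  have hnext : ∀ x : {x // ∃ o, D.missingGraph.Adj x o},
      ∃ y : {x // ∃ o, D.missingGraph.Adj x o}, D.Step x y := by
    rintro ⟨x, o, ho⟩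
    obtain ⟨y, hy⟩ := h.exists_step ho
    obtain ⟨-, o', -, ho'⟩ := hy.exists_adj
    exact ⟨⟨y, o', ho'⟩, hy⟩
  choose f hf using hnext
  obtain ⟨-, o', -, ho'⟩ := hs.exists_adj
  let u : ℕ → V := fun i => (f^[i] ⟨b, o', ho'⟩).1
  have hu : ∀ i, D.Step (u i) (u (i + 1)) := fun i => by
    simp only [u, Function.iterate_succ_apply']
    exact hf _
  -- Injectivity on components cancels a common prefix, so a repetition found by pigeonhole moves
  -- back to the start.
  have back : ∀ i j, D.missingGraph.Reachable (u i) (u (i + j)) →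
      D.missingGraph.Reachable (u 0) (u j) := by
    intro i j
    induction i with
    | zero => simp
    | succ i ih =>
      intro hr
      refine ih (h.reachable_source (hu i) (hu _) ?_)
      rwa [show i + j + 1 = i + 1 + j by ring]
  obtain ⟨i, j, hij, he⟩ := Finite.exists_ne_map_eq_of_infinite u
  wlog hlt : i < j generalizing i j
  · exact this j i hij.symm he.symm (by omega)
  obtain ⟨n, rfl⟩ := Nat.exists_eq_add_of_lt hlt
  have := back i (n + 1) (by rw [← add_assoc, ← he])
  exact ⟨u, n, rfl, hu, (h.reachable_source hs (hu n) this).symm⟩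

/-- A vertex which is not whole is joined by steps to its neighbours in the missing graph. -/
theorem reflTransGen_of_adj [Finite V] {a o : V} (hao : D.missingGraph.Adj a o) :
    Relation.ReflTransGen D.Step a o := by
  classical
  obtain ⟨b, hb⟩ := h.exists_step hao
  obtain ⟨u, n₀, h0, hu, hn₀⟩ := h.exists_closed_sequence hb
  have hex : ∃ n, D.missingGraph.Reachable (u n) a := ⟨n₀, hn₀⟩
  obtain ⟨n, hn, hmin⟩ : ∃ n, D.missingGraph.Reachable (u n) a ∧
      ∀ m < n, ¬ D.missingGraph.Reachable (u m) a :=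
    ⟨Nat.find hex, Nat.find_spec hex, fun m hm => Nat.find_min hex hm⟩
  -- Until the first return, domination of `a` is passed on along the steps.
  have key : ∀ m < n, D.Adj (u m) a := by
    intro m
    induction m with
    | zero => exact fun _ => h0 ▸ h.adj_of_step hb
    | succ m ih => exact fun hm => (hu m).adj_of_adj (ih (by omega)) (hmin _ hm)
  have hreach : ∀ m, Relation.ReflTransGen D.Step a (u m) := by
    intro m
    induction m with
    | zero => exact h0 ▸ Relation.ReflTransGen.single hb
    | succ m ih => exact ih.tail (hu m)
  obtain ⟨p, hp, hpa⟩ : ∃ p, Relation.ReflTransGen D.Step a p ∧ D.Step p (u n) ∧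
      (p = a ∨ D.Adj p a) := by
    rcases n with _ | n
    · exact ⟨a, .refl, h0 ▸ hb, Or.inl rfl⟩
    · exact ⟨u n, hreach n, hu n, Or.inr (key n (by omega))⟩
  -- If the return is opposite `a`, its twin `o` is a target of `p`. If it is a twin of `a`, then
  -- `p` steps to `a`, so `a` dominates `p`, which is impossible.
  rcases h.twin_or_adj hao hn.symm with h1 | h1
  · exact hp.tail (h.step_of_twin_right hpa.1 ⟨a, h1.symm, hao⟩)
  · have := h.adj_of_step (h.step_of_twin_right hpa.1 h1.symm)
    rcases hpa.2 with rfl | h2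
    · exact absurd this (h.irrefl _)
    · exact absurd this (h.oriented.asymm _ _ h2)

theorem reflTransGen_of_reachable [Finite V] {a b : V} (hr : D.missingGraph.Reachable a b) :
    Relation.ReflTransGen D.Step a b := by
  obtain ⟨p⟩ := hr
  induction p with
  | nil => exact .refl
  | cons hab p ih => exact (h.reflTransGen_of_adj hab).trans ih

theorem reflTransGen_symm [Finite V] {a b : V} (hr : Relation.ReflTransGen D.Step a b) :
    Relation.ReflTransGen D.Step b a := by
  induction hr with
  | refl => exact .refl
  | tail _ hs ih =>
    refine Relation.ReflTransGen.trans ?_ ih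
    obtain ⟨u, n, h0, hu, hn⟩ := h.exists_closed_sequence hs
    refine Relation.ReflTransGen.trans ?_ (h.reflTransGen_of_reachable hn)
    clear hn
    induction n with
    | zero => exact h0 ▸ .refl
    | succ n ih => exact ih.tail (hu n)

/-- The classes of vertices joined by steps are modules. -/
theorem adj_of_reflTransGen [Finite V] {a b w : V} (hr : Relation.ReflTransGen D.Step a b)
    (hw : ¬ Relation.ReflTransGen D.Step a w) (haw : D.Adj a w) : D.Adj b w := by
  induction hr with
  | refl => exact haw
  | tail h1 hs ih =>
    exact hs.adj_of_adj ih
      fun hbw => hw ((h1.tail hs).trans (h.reflTransGen_of_reachable hbw))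

/-- No vertex of a class is dominated by both ends of a missing edge of that class. -/
theorem not_adj_both {a o w : V} (hr : Relation.ReflTransGen D.Step a w)
    (ho : D.missingGraph.Adj a o) (haw : D.Adj a w) : ¬ D.Adj o w := by
  induction hr using Relation.ReflTransGen.head_induction_on generalizing o with
  | refl => exact fun _ => h.irrefl _ haw
  | @head a b hs _ ih =>
    intro how
    obtain ⟨-, o', -, ho'⟩ := hs.exists_adj
    have hs' := h.step_opposite hs ho ho'
    -- The arcs into `w` move along both parallel steps until they reach its component; there `a` or
    -- `o` steps to `w` and so is dominated by it.
    by_cases hbw : D.missingGraph.Reachable b w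
    · rcases h.twin_or_adj ho' hbw with h1 | h1
      · exact h.oriented.asymm _ _ how
          (h.adj_of_step (h.step_of_twin_right hs' ⟨b, ho'.symm, h1⟩))
      · exact h.oriented.asymm _ _ haw (h.adj_of_step (h.step_of_twin_right hs h1))
    · exact ih ho' (hs.adj_of_adj haw hbw) (hs'.adj_of_adj how
        fun h' => hbw (ho'.reachable.trans h'))

/-! ### The second neighbourhood property inside a class -/

/-- Every class of twins contains a vertex without out-neighbours in this class. -/
theorem exists_twin_sink {a o : V} (ho : D.missingGraph.Adj a o) :
    ∃ v, D.Twin a v ∧ ∀ w, D.Twin v w → ¬ D.Adj v w := by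
  by_cases hv : ∃ v, D.Twin a v ∧ D.Adj a v
  · obtain ⟨v, ⟨y, h1, h2⟩, hav⟩ := hv
    refine ⟨v, ⟨y, h1, h2⟩, ?_⟩
    rintro w ⟨z, h3, h4⟩ hvw
    rcases h.no_long_walk h1 h2 h3 with rfl | rfl
    · exact h.irrefl _ hav
    · rcases h.degree_le_two h1.symm h2 h4 with rfl | rfl | rfl
      · exact h.irrefl _ hav
      · exact h.oriented.asymm _ _ hav hvw
      · exact h.irrefl _ hvw
  · push Not at hv
    exact ⟨a, ⟨o, ho, ho.symm⟩, fun w hw => hv w hw⟩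

/-- In-neighbours of `b` in other components are second out-neighbours of a vertex stepping
to `b`. -/
theorem mem_secondOutNbhd_of_adj [Finite V] {u v b o : V} (hs : D.Step v b)
    (hvu : Relation.ReflTransGen D.Step v u) (ho : D.missingGraph.Adj u o) (hub : D.Adj u b)
    (htw : ¬ D.Twin u b) : u ∈ D.secondOutNbhd v := by
  have hbv := h.adj_of_step hs
  have hnr : ¬ D.missingGraph.Reachable u b := fun hr =>
    (h.twin_or_adj ho hr).elim (fun h' => h'.2.1 hub) htw
  obtain ⟨y₀, c₀, hl₀⟩ := id hs
  have hnvu : ¬ D.Adj v u := fun hvu => hl₀.fst_two u hvu hub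
  refine ⟨?_, hnvu, ?_⟩
  · rintro rfl
    exact h.oriented.asymm _ _ hub hbv
  obtain ⟨p, w, o', hl⟩ := h.exists_step_to ho
  have hwo' : D.Step w o' := ⟨p, u, hl.symm⟩
  have hpu : D.Step p u := ⟨w, o', hl⟩
  refine ⟨w, ?_, hl.snd⟩
  have hnvw : ¬ D.missingGraph.Reachable v w := fun hr => hnr
    (h.reachable_target hpu hs (hl.left.reachable.trans hr.symm))
  -- Otherwise `w` dominates `v`, and so does `o'` by a step; then both ends of the missing edge `u
  -- o'` dominate `v`, unless `u` and `v` share a component.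
  by_contra hvw
  have hwv : D.Adj w v := by
    by_contra hwv
    refine hnvw (SimpleGraph.Adj.reachable ⟨?_, hvw, hwv⟩)
    rintro rfl
    exact hnvw (SimpleGraph.Reachable.refl _)
  by_cases hr : D.missingGraph.Reachable u v
  · rcases h.twin_or_adj ho hr with h1 | h1
    · exact hvw (h.adj_of_step (h.step_of_twin_right hwo' ⟨u, hl.right, h1⟩))
    · exact h.oriented.asymm _ _ hub (h.adj_of_step (h.step_of_twin_left hs h1.symm))
  · have huv : D.Adj u v := by
      by_contra huv
      refine hr (SimpleGraph.Adj.reachable ⟨?_, huv, hnvu⟩)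
      rintro rfl
      exact hr (SimpleGraph.Reachable.refl _)
    exact h.not_adj_both (h.reflTransGen_symm hvu) hl.right.symm huv
      (hwo'.adj_of_adj hwv fun h' => hr (hl.right.symm.reachable.trans h'))

/-- Every class contains a vertex with the second neighbourhood property relative to the class. -/
theorem exists_ncard_le_in_class [Finite V] (a : V) :
    ∃ v, Relation.ReflTransGen D.Step a v ∧
      {w | Relation.ReflTransGen D.Step a w ∧ D.Adj v w}.ncard ≤
        {w | Relation.ReflTransGen D.Step a w ∧ w ∈ D.secondOutNbhd v}.ncard := by
  by_cases hwhole : ∃ o, D.missingGraph.Adj a o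
  swap
  · refine ⟨a, .refl, ?_⟩
    have : {w | Relation.ReflTransGen D.Step a w ∧ D.Adj a w} = ∅ := by
      rw [Set.eq_empty_iff_forall_notMem]
      rintro w ⟨hw, haw⟩
      rcases hw.cases_head with rfl | ⟨c, hs, -⟩
      · exact h.irrefl _ haw
      · obtain ⟨o, -, ho, -⟩ := hs.exists_adj
        exact hwhole ⟨o, ho⟩
    rw [this, Set.ncard_empty]
    exact Nat.zero_le _
  obtain ⟨o₀, ho₀⟩ := hwhole
  let M : V → Set V := fun b => {u | Relation.ReflTransGen D.Step a u ∧ D.Adj u b ∧ ¬ D.Twin u b}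
  -- Take `b` with the most non-twin in-neighbours in the class and `v` stepping to `b`, a sink
  -- among its twins. For a missing neighbour `o'` of `v`, out-neighbours of `v` in the class lie in
  -- `M o'`, while `M b` lies in the second out-neighbourhood of `v`.
  obtain ⟨b, hb, hmax⟩ := Set.exists_max_image {b | Relation.ReflTransGen D.Step a b}
    (fun b => (M b).ncard) (Set.toFinite _) ⟨a, .refl⟩
  obtain ⟨o, ho⟩ := exists_adj_of_reflTransGen ho₀ hb
  obtain ⟨v₀, hv₀⟩ := h.exists_step_to ho
  obtain ⟨o₁, -, ho₁, -⟩ := hv₀.exists_adj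
  obtain ⟨v, hv, hsink⟩ := h.exists_twin_sink ho₁
  have hs := h.step_of_twin_left hv₀ hv
  have hav : Relation.ReflTransGen D.Step a v := hb.trans (h.reflTransGen_symm (.single hs))
  obtain ⟨o', -, ho', -⟩ := hs.exists_adj
  refine ⟨v, hav, ?_⟩
  calc _ ≤ (M o').ncard := by
        refine Set.ncard_le_ncard ?_ (Set.toFinite _)
        rintro w ⟨haw, hvw⟩
        have hnr : ¬ D.missingGraph.Reachable v w := fun hr =>
          (h.twin_or_adj ho' hr).elim (fun h' => h'.2.1 hvw) fun h' => hsink w h' hvw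
        have hnow : ¬ D.Adj o' w :=
          h.not_adj_both ((h.reflTransGen_symm hav).trans haw) ho' hvw
        refine ⟨haw, ?_, fun ht => hnr (ho'.reachable.trans ht.symm.reachable)⟩
        by_contra hwo
        refine hnr (ho'.reachable.trans (SimpleGraph.Adj.reachable ⟨?_, hnow, hwo⟩))
        rintro rfl
        exact hnr ho'.reachable
    _ ≤ (M b).ncard := hmax o' (hav.trans (h.reflTransGen_of_adj ho'))
    _ ≤ _ := by
        refine Set.ncard_le_ncard ?_ (Set.toFinite _)
        rintro u ⟨hau, hub, ht⟩
        obtain ⟨o₂, ho₂⟩ := exists_adj_of_reflTransGen ho₀ hau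
        exact ⟨hau, h.mem_secondOutNbhd_of_adj hs ((h.reflTransGen_symm hav).trans hau) ho₂ hub ht⟩

end LosingRegular

/-! ### Gluing the classes together -/

/-- If contracting the fibres of `f` turns `D` into a tournament, and every fibre contains a vertex
with the second neighbourhood property relative to the fibre, then `D` has such a vertex. -/
theorem exists_hasSNP_of_modules [Finite V] {Q : Type*} [Finite Q] [Nonempty Q]
    {R : Q → Q → Prop} (htotal : ∀ a b, a ≠ b → R a b ∨ R b a) (hasymm : ∀ a b, R a b → ¬ R b a)
    (f : V → Q) (hf : ∀ u v, f u ≠ f v → (D.Adj u v ↔ R (f u) (f v)))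
    (hfib : ∀ q, ∃ v, f v = q ∧ {w | f w = q ∧ D.Adj v w}.ncard ≤
      {w | f w = q ∧ w ∈ D.secondOutNbhd v}.ncard) :
    ∃ v, D.HasSNP v := by
  classical
  have := Fintype.ofFinite Q
  have := Fintype.ofFinite V
  have hirr : ∀ q, ¬ R q q := fun q hq => hasymm q q hq hq
  obtain ⟨q, hq⟩ := exists_weight_out_le_weight_second (R := R)
    (w := fun q => {w | f w = q}.ncard) htotal hasymm fun q => by
      obtain ⟨v, hv, -⟩ := hfib q
      exact (Set.ncard_pos (Set.toFinite _)).2 ⟨v, hv⟩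
  have hsum : ∀ (p : Q → Prop) [DecidablePred p], (∑ b with p b, {w | f w = b}.ncard) = {w | p (f w)}.ncard := by
    intro p _
    rw [Set.ncard_eq_toFinset_card', Finset.card_eq_sum_card_fiberwise (f := f)
      (t := Finset.univ.filter p) (by intro; simp)]
    refine Finset.sum_congr rfl fun b hb => ?_
    rw [Set.ncard_eq_toFinset_card']
    congr 1
    ext w
    simp only [Finset.mem_filter, Finset.mem_univ, true_and] at hb
    simp only [Set.mem_toFinset, Set.mem_ofPred_eq, Finset.mem_filter]
    exact ⟨fun hw => ⟨hw ▸ hb, hw⟩, And.right⟩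
  obtain ⟨v, rfl, hv⟩ := hfib q
  refine ⟨v, ?_⟩
  have h1 : D.outNbhd v = {w | f w = f v ∧ D.Adj v w} ∪ {w | R (f v) (f w)} := by
    ext w
    simp only [outNbhd, Set.mem_ofPred_eq, Set.mem_union]
    by_cases hw : f w = f v
    · simp [hw, hirr]
    · simp [hw, hf v w (Ne.symm hw)]
  have h2 : {w | f w = f v ∧ w ∈ D.secondOutNbhd v} ∪
      {w | R (f w) (f v) ∧ ∃ u, R (f v) u ∧ R u (f w)} ⊆ D.secondOutNbhd v := by
    rintro w (hw | ⟨hwv, r, hvr, hrw⟩)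
    · exact hw.2
    · obtain ⟨u, rfl, -⟩ := hfib r
      have hne : f v ≠ f w := fun h' => hirr _ (h' ▸ hwv)
      refine ⟨fun h' => hne (h' ▸ rfl), fun h' => hasymm _ _ hwv ((hf v w hne).1 h'), u,
        (hf v u fun h' => hirr (f v) ?_).2 hvr, (hf u w fun h' => hirr (f u) ?_).2 hrw⟩
      · rwa [← h'] at hvr
      · rwa [← h'] at hrw
  rw [hsum, hsum] at hq
  calc (D.outNbhd v).ncard ≤ _ := by
        rw [h1]
        exact Set.ncard_union_le _ _
    _ ≤ _ := Nat.add_le_add hv hq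
    _ = _ := (Set.ncard_union_eq (by
        rw [Set.disjoint_left]
        rintro w ⟨hw, -⟩ ⟨hw', -⟩
        exact hirr (f v) (hw ▸ hw')) (Set.toFinite _) (Set.toFinite _)).symm
    _ ≤ _ := Set.ncard_le_ncard h2 (Set.toFinite _)

theorem LosingRegular.exists_hasSNP [Finite V] [Nonempty V] (h : D.LosingRegular) :
    ∃ v, D.HasSNP v := by
  let S : Setoid V := ⟨Relation.ReflTransGen D.Step, fun _ => .refl, h.reflTransGen_symm,
    Relation.ReflTransGen.trans⟩
  have hmk : ∀ u v, (Quotient.mk S u = Quotient.mk S v) ↔ Relation.ReflTransGen D.Step u v :=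
    fun u v => Quotient.eq
  have htot : ∀ u v, Quotient.mk S u ≠ Quotient.mk S v → D.Adj u v ∨ D.Adj v u := by
    intro u v huv
    by_contra hno
    push Not at hno
    exact huv ((hmk u v).2 (h.reflTransGen_of_adj ⟨fun h' => huv (h' ▸ rfl), hno.1, hno.2⟩))
  have hmod : ∀ u u' v v', Quotient.mk S u = Quotient.mk S u' → Quotient.mk S v = Quotient.mk S v' →
      Quotient.mk S u ≠ Quotient.mk S v → D.Adj u v → D.Adj u' v' := by
    intro u u' v v' hu hv hne huv
    -- Replace the tail by the module property, then the head by excluding the reverse arc.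
    have h1 : D.Adj u' v := h.adj_of_reflTransGen ((hmk _ _).1 hu) (fun h' => hne ((hmk _ _).2 h')) huv
    refine (htot u' v' (hu ▸ hv ▸ hne)).resolve_right fun h2 => ?_
    exact h.oriented.asymm _ _ h1 (h.adj_of_reflTransGen ((hmk _ _).1 hv.symm)
      (fun h' => hne (hu.trans (hv.trans ((hmk _ _).2 h')).symm)) h2)
  have : Nonempty (Quotient S) := ⟨Quotient.mk S (Classical.arbitrary V)⟩
  refine exists_hasSNP_of_modules (Q := Quotient S)
    (R := fun q r => q ≠ r ∧ ∃ u v, Quotient.mk S u = q ∧ Quotient.mk S v = r ∧ D.Adj u v)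
    ?_ ?_ (Quotient.mk S) ?_ ?_
  · rintro ⟨a⟩ ⟨b⟩ hab
    exact (htot a b hab).imp (fun h' => ⟨hab, a, b, rfl, rfl, h'⟩)
      fun h' => ⟨hab.symm, b, a, rfl, rfl, h'⟩
  · rintro _ _ ⟨hne, u, v, rfl, rfl, huv⟩ ⟨-, v', u', hv, hu, hvu⟩
    exact h.oriented.asymm _ _ huv (hmod _ _ _ _ hv hu (by rw [hv, hu]; exact hne.symm) hvu)
  · refine fun u v hne => ⟨fun huv => ⟨hne, u, v, rfl, rfl, huv⟩, ?_⟩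
    rintro ⟨-, u', v', hu, hv, huv⟩
    exact hmod _ _ _ _ hu hv (by rwa [hu, hv]) huv
  · rintro ⟨a⟩
    obtain ⟨v, hav, hv⟩ := h.exists_ncard_le_in_class a
    refine ⟨v, ((hmk _ _).2 hav).symm, ?_⟩
    have he : ∀ w, (Quotient.mk S w = Quot.mk _ a) ↔ Relation.ReflTransGen D.Step a w :=
      fun w => eq_comm.trans (hmk a w)
    simpa only [he] using hv

end Digraph

theorem mainTheorem2 {V : Type*} [Finite V] [Nonempty V] (D : Digraph V)
    (hD : D.IsOrientedGraph) (hmiss : D.MissesDisjointPathsOfLengthTwo)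
    (hreg : ∀ e : D.missingGraph.edgeSet,
      D.dependencyDigraph.outDeg e = 2 ∧ D.dependencyDigraph.inDeg e = 2) :
    ∃ v : V, D.HasSNP v :=
  (Digraph.losingRegular_of_degree_two hD hmiss hreg).exists_hasSNP
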